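/- Let $\varphi=(1+\sqrt5)/2$, and let $\mathbb{O}$ be the real octonions with multiplicative norm $N$, conjugation $x\mapsto\bar x$, polar form $B(x,y)=N(x+y)-N(x)-N(y)$ and Euclidean inner product $\langle x,y\rangle=\tfrac12B(x,y)$. A $\mathbb{Z}[\varphi]$-order in $\mathbb{O}$ is a finitely generated $\mathbb{Z}[\varphi]$-submodule $\mathcal{G}\subset\mathbb{O}$ with $1\in\mathcal{G}$, $\overline{\mathcal{G}}=\mathcal{G}$, $\mathcal{G}\cdot\mathcal{G}\subseteq\mathcal{G}$, $N(\mathcal{G})\subseteq\mathbb{Z}[\varphi]$ and $B(\mathcal{G},\mathcal{G})\subseteq\mathbb{Z}[\varphi]$. Its unit shell is $\mathcal{S}_1(\mathcal{G})=\{x\in\mathcal{G}:N(x)=1\}$. A finite subset $T$ of a Euclidean space is a root-shell system over $\mathbb{Z}[\varphi]$ if $T=-T$; all elements of $T$ have the same positive length; for every $\alpha\in T$ the reflection $r_\alpha(x)=x-\frac{2\langle x,\alpha\rangle}{\langle\alpha,\alpha\rangle}\alpha$ maps $T$ onto itself; and $\frac{2\langle\alpha,\beta\rangle}{\langle\alpha,\alpha\rangle}\in\mathbb{Z}[\varphi]$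 for all $\alpha,\beta\in T$. It is indecomposable if it is non-empty and is not the union of two non-empty mutually orthogonal subsets; it is non-crystallographic if $\frac{2\langle\alpha,\beta\rangle}{\langle\alpha,\alpha\rangle}\notin\mathbb{Z}$ for some $\alpha,\beta\in T$. Its real rank is $\dim_{\mathbb{R}}\operatorname{span}_{\mathbb{R}}T$. **Corollary.** There is no $\mathbb{Z}[\varphi]$-order $\mathcal{G}\subset\mathbb{O}$ whose unit shell $\mathcal{S}_1(\mathcal{G})$ is an indecomposable non-crystallographic root-shell system over $\mathbb{Z}[\varphi]$ of full real rank $8$. -/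

import Mathlib

open scoped Quaternion

noncomputable section

/-- The real octonions `𝕆`, as the Cayley–Dickson double `ℍ ⊕ ℍ` of Hamilton's quaternions.
The underlying real vector space carries the Euclidean structure of the orthogonal sum. -/
def Octonion : Type := WithLp 2 (ℍ[ℝ] × ℍ[ℝ])

namespace Octonion

instance : NormedAddCommGroup Octonion :=
  inferInstanceAs (NormedAddCommGroup (WithLp 2 (ℍ[ℝ] × ℍ[ℝ])))

instance : InnerProductSpace ℝ Octonion :=
  inferInstanceAs (InnerProductSpace ℝ (WithLp 2 (ℍ[ℝ] × ℍ[ℝ])))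

/-- The octonion `a + b ℓ` with quaternions `a`, `b`. -/
def mk (a b : ℍ[ℝ]) : Octonion := WithLp.toLp 2 (a, b)

/-- The first quaternionic component. -/
def fst (x : Octonion) : ℍ[ℝ] := (WithLp.ofLp x).1

/-- The second quaternionic component. -/
def snd (x : Octonion) : ℍ[ℝ] := (WithLp.ofLp x).2

/-- The unit element `1`. -/
instance : One Octonion := ⟨mk 1 0⟩

/-- The Cayley–Dickson product `(a, b)(c, d) = (a c - d̄ b, d a + b c̄)`. -/
instance : Mul Octonion :=
  ⟨fun x y => mk (x.fst * y.fst - star y.snd * x.snd) (y.snd * x.fst + x.snd * star y.fst)⟩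

/-- The canonical involution `x ↦ x̄`, `(a, b) ↦ (ā, -b)`. -/
def conj (x : Octonion) : Octonion := mk (star x.fst) (-x.snd)

/-- The composition norm `N`, the sum of the squares of the eight real coordinates. -/
def N (x : Octonion) : ℝ := Quaternion.normSq x.fst + Quaternion.normSq x.snd

/-- The polar form `B(x, y) = N(x + y) - N(x) - N(y)`. -/
def B (x y : Octonion) : ℝ := N (x + y) - N x - N y

/-- The composition norm is the square of the Euclidean norm. -/
theorem N_eq_norm_sq (x : Octonion) : N x = ‖x‖ ^ 2 := by
  have h : ‖x‖ ^ 2 = ‖x.fst‖ ^ 2 + ‖x.snd‖ ^ 2 :=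
    WithLp.prod_norm_sq_eq_of_L2 (α := ℍ[ℝ]) (β := ℍ[ℝ]) x
  rw [h, N, Quaternion.normSq_eq_norm_mul_self, Quaternion.normSq_eq_norm_mul_self]
  ring

/-- The octonion norm is multiplicative. -/
theorem N_mul (x y : Octonion) : N (x * y) = N x * N y := by
  change Quaternion.normSq (x.fst * y.fst - star y.snd * x.snd)
      + Quaternion.normSq (y.snd * x.fst + x.snd * star y.fst)
    = (Quaternion.normSq x.fst + Quaternion.normSq x.snd)
      * (Quaternion.normSq y.fst + Quaternion.normSq y.snd)
  simp only [Quaternion.normSq_def', Quaternion.re_sub, Quaternion.imI_sub, Quaternion.imJ_sub,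
    Quaternion.imK_sub, Quaternion.re_add, Quaternion.imI_add, Quaternion.imJ_add,
    Quaternion.imK_add, Quaternion.re_mul, Quaternion.imI_mul, Quaternion.imJ_mul,
    Quaternion.imK_mul, Quaternion.re_star, Quaternion.imI_star, Quaternion.imJ_star,
    Quaternion.imK_star]
  ring

/-- An `R`-order in the octonions, for a subring `R` of `ℝ`: a finitely generated `R`-submodule
that contains `1`, is stable under conjugation and multiplication, and on which the norm and its
polar form take values in `R`. -/
structure IsOrder (R : Subring ℝ) (O : Submodule R Octonion) : Prop where
  fg : O.FG
  one_mem : (1 : Octonion) ∈ O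
  conj_image : conj '' (O : Set Octonion) = (O : Set Octonion)
  mul_mem : ∀ x ∈ O, ∀ y ∈ O, x * y ∈ O
  N_mem : ∀ x ∈ O, N x ∈ R
  B_mem : ∀ x ∈ O, ∀ y ∈ O, B x y ∈ R

/-- The unit shell `{x ∈ O : N(x) = 1}`. -/
def unitShell {R : Subring ℝ} (O : Submodule R Octonion) : Set Octonion :=
  {x | x ∈ O ∧ N x = 1}

end Octonion

/-- The ring `ℤ[φ]`, as the subring of `ℝ` generated by the golden ratio `φ = (1 + √5) / 2`. -/
def goldenIntegers : Subring ℝ := Subring.closure {Real.goldenRatio}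

section RootShell

variable {V : Type*} [NormedAddCommGroup V] [InnerProductSpace ℝ V]

/-- The Cartan coefficient `2⟨α, β⟩ / ⟨α, α⟩`. -/
def cartanCoeff (α β : V) : ℝ := 2 * inner ℝ α β / inner ℝ α α

/-- The reflection `r_α(x) = x - (2⟨x, α⟩ / ⟨α, α⟩) α`. -/
def rootReflection (α x : V) : V := x - (2 * inner ℝ x α / inner ℝ α α) • α

/-- A root-shell system over a subring `R` of `ℝ`: a finite, centrally symmetric set of vectors of
one common positive length, preserved by the reflection in each of its members, with all Cartan
coefficients in `R`. -/
structure IsRootShellSystem (R : Subring ℝ) (T : Set V) : Prop where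
  finite : T.Finite
  neg_image : (fun x => -x) '' T = T
  single_sphere : ∃ r : ℝ, 0 < r ∧ ∀ x ∈ T, ‖x‖ = r
  reflection_image : ∀ α ∈ T, rootReflection α '' T = T
  cartan_mem : ∀ α ∈ T, ∀ β ∈ T, cartanCoeff α β ∈ R

/-- `T` is indecomposable: it is non-empty and is not the union of two non-empty, mutually
orthogonal subsets. -/
def IsIndecomposable (T : Set V) : Prop :=
  T.Nonempty ∧ ¬ ∃ T₁ T₂ : Set V, T₁.Nonempty ∧ T₂.Nonempty ∧ T₁ ∪ T₂ = T ∧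
    ∀ x ∈ T₁, ∀ y ∈ T₂, inner ℝ x y = 0

/-- `T` is non-crystallographic: some Cartan coefficient is not an integer. -/
def IsNonCrystallographic (T : Set V) : Prop :=
  ∃ α ∈ T, ∃ β ∈ T, ∀ n : ℤ, cartanCoeff α β ≠ n

/-- The real rank of `T`, the dimension of its real span. -/
def realRank (T : Set V) : ℕ := Module.finrank ℝ (Submodule.span ℝ T)

end RootShell

end

open Real

/-! An indecomposable non-crystallographic system over `ℤ[φ]` has rank at most 4, so rank 8 is
impossible. The unit shell enters only as a set of Euclidean unit vectors. If c is a Cartan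
coefficient, so is c² - 2. Finiteness of the system therefore bounds the Galois conjugate of c by 2,
as Cauchy–Schwarz bounds c itself, and only the integers -2, …, 2, ±φ and ±(φ - 1) remain
(`cartan_cases`). A non-integral coefficient yields an H₂ base. Suppose a base spans U and some root
lies outside U. By `exists_root_notMem` there is an outside root y, not orthogonal to U, with
coefficients 0, -1 or -φ against the base. Against any root of U, y has coefficient greater than -2;
testing one root with large positive base coordinates leaves only the extensions H₂ → H₃ → H₄, and
none beyond H₄. -/

/-- A finite set of unit vectors, stable under the reflections in its members, whose Cartan
coefficients `2⟨α, β⟩` lie in `ℤ[φ]`. -/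
structure IsGoldenSystem {V : Type*} [NormedAddCommGroup V] [InnerProductSpace ℝ V]
    (T : Set V) : Prop where
  finite : T.Finite
  inner_self : ∀ x ∈ T, inner ℝ x x = 1
  reflection_mem : ∀ α ∈ T, ∀ x ∈ T, x - (2 * inner ℝ x α) • α ∈ T
  cartan_mem : ∀ α ∈ T, ∀ β ∈ T, 2 * inner ℝ α β ∈ goldenIntegers

/-! ### Arithmetic of `ℤ[φ]` -/

theorem exists_int_of_mem_goldenIntegers {x : ℝ} (hx : x ∈ goldenIntegers) :
    ∃ a b : ℤ, x = a + b * goldenRatio := by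
  induction hx using Subring.closure_induction with
  | mem x hx => exact ⟨0, 1, by simp_all⟩
  | zero => exact ⟨0, 0, by simp⟩
  | one => exact ⟨1, 0, by simp⟩
  | add x y _ _ hx hy =>
    obtain ⟨a, b, rfl⟩ := hx
    obtain ⟨c, d, rfl⟩ := hy
    exact ⟨a + c, b + d, by push_cast; ring⟩
  | neg x _ hx =>
    obtain ⟨a, b, rfl⟩ := hx
    exact ⟨-a, -b, by push_cast; ring⟩
  | mul x y _ _ hx hy =>
    obtain ⟨a, b, rfl⟩ := hx
    obtain ⟨c, d, rfl⟩ := hy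
    exact ⟨a * c + b * d, a * d + b * c + b * d, by
      push_cast; linear_combination (b * d : ℝ) * goldenRatio_sq⟩

theorem int_add_int_mul_goldenRatio_injective :
    Function.Injective (fun p : ℤ × ℤ => (p.1 + p.2 * goldenRatio : ℝ)) := by
  rintro ⟨a, b⟩ ⟨c, d⟩ h
  simp only at h
  have hbd : b = d := by
    by_contra hne
    have h0 : (b - d : ℤ) ≠ 0 := sub_ne_zero.2 hne
    refine (goldenRatio_irrational.intCast_mul h0).ne_int (c - a) ?_
    push_cast
    linarith
  subst hbd
  simpa using h

theorem goldenRatio_gt : (1.618 : ℝ) < goldenRatio := by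
  by_contra! h
  nlinarith [goldenRatio_sq, one_lt_goldenRatio]

theorem goldenRatio_lt : goldenRatio < (1.6181 : ℝ) := by
  by_contra! h
  nlinarith [goldenRatio_sq, one_lt_goldenRatio]

/-- The elements of `ℤ[φ]` all of whose conjugates have absolute value at most `2`. -/
theorem int_add_int_mul_goldenRatio_cases {a b : ℤ} (h : |(a + b * goldenRatio : ℝ)| ≤ 2)
    (h' : |(a + b * goldenConj : ℝ)| ≤ 2) :
    (b = 0 ∧ -2 ≤ a ∧ a ≤ 2) ∨ (b = 1 ∧ (a = 0 ∨ a = -1)) ∨ (b = -1 ∧ (a = 0 ∨ a = 1)) := by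
  have hc : goldenConj = 1 - goldenRatio := by linarith [goldenRatio_add_goldenConj]
  have h1 := goldenRatio_gt
  have h2 := goldenRatio_lt
  rw [hc] at h'
  rw [abs_le] at h h'
  -- The two conjugates differ by b√5, so |b| ≤ 4/√5 < 2.
  have hb1 : (b : ℝ) < 2 := by nlinarith
  have hb2 : (-2 : ℝ) < b := by nlinarith
  have hb1' : b < 2 := by exact_mod_cast hb1
  have hb2' : -2 < b := by exact_mod_cast hb2
  obtain rfl | rfl | rfl : b = 0 ∨ b = 1 ∨ b = -1 := by omega
  · left
    simp only [Int.cast_zero, zero_mul, add_zero] at h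
    exact ⟨rfl, by exact_mod_cast h.1, by exact_mod_cast h.2⟩
  · right; left
    simp only [Int.cast_one, one_mul] at h h'
    have : (a : ℝ) < 1 := by linarith
    have h3 : (-2 : ℝ) < a := by linarith
    have : a < 1 := by exact_mod_cast this
    have : -2 < a := by exact_mod_cast h3
    exact ⟨rfl, by omega⟩
  · right; right
    simp only [Int.cast_neg, Int.cast_one, neg_mul, one_mul] at h h'
    have : (a : ℝ) < 2 := by linarith
    have h3 : (-1 : ℝ) < a := by linarith
    have : a < 2 := by exact_mod_cast this
    have : -1 < a := by exact_mod_cast h3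
    exact ⟨rfl, by omega⟩

/-! ### Cartan coefficients and roots outside a subspace -/

namespace IsGoldenSystem

variable {V : Type*} [NormedAddCommGroup V] [InnerProductSpace ℝ V] {T : Set V}

theorem neg_mem (hT : IsGoldenSystem T) {x : V} (hx : x ∈ T) : -x ∈ T := by
  have h := hT.reflection_mem x hx x hx
  rw [hT.inner_self x hx] at h
  convert h using 1
  module

theorem norm_eq_one (hT : IsGoldenSystem T) {x : V} (hx : x ∈ T) : ‖x‖ = 1 := by
  have h := hT.inner_self x hx
  rw [real_inner_self_eq_norm_sq] at h
  nlinarith [norm_nonneg x]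

theorem abs_cartan_le_two (hT : IsGoldenSystem T) {α β : V} (hα : α ∈ T) (hβ : β ∈ T) :
    |2 * inner ℝ α β| ≤ 2 := by
  have h := abs_real_inner_le_norm α β
  rw [hT.norm_eq_one hα, hT.norm_eq_one hβ] at h
  rw [abs_mul, abs_two]
  linarith

theorem reflection_mem_of_eq (hT : IsGoldenSystem T) {α x : V} {c : ℝ} (hα : α ∈ T) (hx : x ∈ T)
    (hc : 2 * inner ℝ x α = c) : x - c • α ∈ T :=
  hc ▸ hT.reflection_mem α hα x hx

/-- The root `2⟨α, β⟩ β - α` has Cartan coefficient `c ^ 2 - 2` with `α`, where `c = 2⟨α, β⟩`. -/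
theorem exists_cartan_sq_sub_two (hT : IsGoldenSystem T) {α β : V} (hα : α ∈ T) (hβ : β ∈ T) :
    ∃ γ ∈ T, 2 * inner ℝ α γ = (2 * inner ℝ α β) ^ 2 - 2 := by
  refine ⟨_, hT.neg_mem (hT.reflection_mem β hβ α hα), ?_⟩
  rw [inner_neg_right, inner_sub_right, real_inner_smul_right, hT.inner_self α hα]
  ring

/-- By finiteness, the Galois conjugates of Cartan coefficients are bounded by `2`. -/
theorem abs_conj_cartan_le_two (hT : IsGoldenSystem T) {α β : V} (hα : α ∈ T) (hβ : β ∈ T)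
    {a b : ℤ} (hab : 2 * inner ℝ α β = a + b * goldenRatio) :
    |(a + b * goldenConj : ℝ)| ≤ 2 := by
  by_contra! hlt
  set S : Set (ℤ × ℤ) := {p | ∃ γ ∈ T, 2 * inner ℝ α γ = p.1 + p.2 * goldenRatio}
  have hS : S.Finite := by
    refine Set.Finite.subset ((hT.finite.image fun γ => (2 * inner ℝ α γ : ℝ)).preimage
      int_add_int_mul_goldenRatio_injective.injOn) ?_
    rintro p ⟨γ, hγ, h⟩
    exact ⟨γ, hγ, h⟩
  -- The largest conjugate has absolute value m > 2, but then m² - 2 > m is the conjugate of another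
  -- coefficient.
  obtain ⟨⟨c, d⟩, ⟨γ, hγ, hcd⟩, hmax⟩ :=
    Set.exists_max_image S (fun p => |(p.1 + p.2 * goldenConj : ℝ)|) hS ⟨(a, b), β, hβ, hab⟩
  simp only at hmax hcd
  obtain ⟨δ, hδ, hδc⟩ := hT.exists_cartan_sq_sub_two hα hγ
  have h1 := hmax (a, b) ⟨β, hβ, hab⟩
  have h2 := hmax (c ^ 2 + d ^ 2 - 2, 2 * c * d + d ^ 2) ⟨δ, hδ, by
    rw [hδc, hcd]
    push_cast
    linear_combination (d : ℝ) ^ 2 * goldenRatio_sq⟩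
  have h3 : ((c ^ 2 + d ^ 2 - 2 : ℤ) + (2 * c * d + d ^ 2 : ℤ) * goldenConj : ℝ)
      = |(c + d * goldenConj : ℝ)| ^ 2 - 2 := by
    rw [sq_abs]
    push_cast
    linear_combination -(d : ℝ) ^ 2 * goldenConj_sq
  rw [h3] at h2
  have h4 := le_abs_self (|(c + d * goldenConj : ℝ)| ^ 2 - 2)
  simp only at h1
  nlinarith

theorem cartan_cases (hT : IsGoldenSystem T) {α β : V} (hα : α ∈ T) (hβ : β ∈ T) :
    (∃ n : ℤ, -2 ≤ n ∧ n ≤ 2 ∧ 2 * inner ℝ α β = n) ∨ 2 * inner ℝ α β = goldenRatio ∨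
      2 * inner ℝ α β = -goldenRatio ∨ 2 * inner ℝ α β = goldenRatio - 1 ∨
      2 * inner ℝ α β = 1 - goldenRatio := by
  obtain ⟨a, b, hab⟩ := exists_int_of_mem_goldenIntegers (hT.cartan_mem α hα β hβ)
  have h := hT.abs_cartan_le_two hα hβ
  rw [hab] at h ⊢
  rcases int_add_int_mul_goldenRatio_cases h (hT.abs_conj_cartan_le_two hα hβ hab) with
    ⟨rfl, h1, h2⟩ | ⟨rfl, rfl | rfl⟩ | ⟨rfl, rfl | rfl⟩
  · exact .inl ⟨a, h1, h2, by simp⟩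
  · exact .inr (.inl (by simp))
  · exact .inr (.inr (.inr (.inl (by push_cast; ring))))
  · exact .inr (.inr (.inl (by simp)))
  · exact .inr (.inr (.inr (.inr (by push_cast; ring))))

/-- Equality in Cauchy–Schwarz would force y = -α, which lies in U. -/
theorem neg_two_lt_cartan (hT : IsGoldenSystem T) {U : Submodule ℝ V} {y α : V} (hy : y ∈ T)
    (hyU : y ∉ U) (hα : α ∈ T) (hαU : α ∈ U) : -2 < 2 * inner ℝ y α := by
  have h := abs_le.1 (hT.abs_cartan_le_two hy hα)
  refine lt_of_le_of_ne h.1 fun heq => hyU ?_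
  have h1 : inner ℝ y (-α) = 1 := by rw [inner_neg_right]; linarith
  rw [inner_eq_one_iff_of_norm_eq_one (hT.norm_eq_one hy) (hT.norm_eq_one (hT.neg_mem hα))] at h1
  rw [h1]
  exact U.neg_mem hαU

/-- If `T` meets the subspace `U` without being contained in it, there is a root outside `U`, not
orthogonal to `U`, that is antidominant for the functional `ρ` and as close to `U` as possible;
the latter excludes the Cartan coefficients `±(φ - 1)`. -/
theorem exists_root_notMem (hT : IsGoldenSystem T) (hind : IsIndecomposable T)
    (U : Submodule ℝ V) [FiniteDimensional ℝ U] (hU : ∃ x ∈ T, x ∈ U) (hTU : ¬ T ⊆ U) (ρ : V) :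
    ∃ y ∈ T, y ∉ U ∧ (∃ x ∈ U, inner ℝ x y ≠ 0) ∧
      ∀ α ∈ T, α ∈ U → 0 < inner ℝ α ρ →
        2 * inner ℝ y α = 0 ∨ 2 * inner ℝ y α = -1 ∨ 2 * inner ℝ y α = -goldenRatio := by
  -- `b` is the distance to U.
  set b : V → ℝ := fun y => ‖Uᗮ.starProjection y‖ with hb
  have hbU : ∀ x ∈ U, Uᗮ.starProjection x = 0 := fun x hx => by
    rw [Submodule.starProjection_apply_eq_zero_iff]
    exact Submodule.le_orthogonal_orthogonal U hx
  have hb0 : ∀ y, y ∉ U → 0 < b y := fun y hy => by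
    rw [hb, norm_pos_iff]
    intro h
    rw [Submodule.starProjection_apply_eq_zero_iff, Submodule.orthogonal_orthogonal] at h
    exact hy h
  set S : Set V := {y | y ∈ T ∧ y ∉ U ∧ ∃ x ∈ U, inner ℝ x y ≠ 0} with hS
  have hSfin : S.Finite := hT.finite.subset fun y hy => hy.1
  -- Otherwise the roots in U and those outside would decompose T orthogonally.
  have hSne : S.Nonempty := by
    by_contra! hempty
    refine hind.2 ⟨T ∩ U, T \ U, hU, Set.sdiff_nonempty.2 hTU, Set.inter_union_sdiff T U, ?_⟩
    intro x hx y hy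
    by_contra hne
    have : y ∈ S := ⟨hy.1, hy.2, x, hx.2, hne⟩
    simp [hempty] at this
  -- Minimise the distance to U first, then the pairing with ρ. Reflecting in a root of U preserves
  -- the distance and, when ⟨y, α⟩ > 0, lowers the pairing.
  obtain ⟨y₀, hy₀, hmin₀⟩ := Set.exists_min_image S b hSfin hSne
  obtain ⟨y, ⟨hyS, hyb⟩, hmin⟩ := Set.exists_min_image {y | y ∈ S ∧ b y = b y₀}
    (fun y => inner ℝ y ρ) (hSfin.subset fun y hy => hy.1) ⟨y₀, hy₀, rfl⟩
  obtain ⟨hyT, hyU, hyne⟩ := hyS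
  have hφ := goldenRatio_gt
  have hφ' := goldenRatio_lt
  refine ⟨y, hyT, hyU, hyne, fun α hα hαU hαρ => ?_⟩
  have hle : inner ℝ y α ≤ 0 := by
    by_contra! hpos
    have hy' : y - (2 * inner ℝ y α) • α ∈ {y | y ∈ S ∧ b y = b y₀} := by
      refine ⟨⟨hT.reflection_mem α hα y hyT, fun h => hyU ?_, α, hαU, ?_⟩, ?_⟩
      · simpa using U.add_mem h (U.smul_mem (2 * inner ℝ y α) hαU)
      · rw [inner_sub_right, real_inner_smul_right, hT.inner_self α hα, real_inner_comm]
        linarith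
      · simp only [hb, map_sub, map_smul, hbU α hαU, smul_zero, sub_zero]
        exact hyb
    have h := hmin _ hy'
    simp only [inner_sub_left, real_inner_smul_left] at h
    nlinarith [mul_pos hpos hαρ]
  have hnot : 2 * inner ℝ y α ≠ 1 - goldenRatio := by
    intro hc
    -- Reflecting α in y gives a root whose distance to U is φ - 1 < 1 times that of y.
    have hy' : α - (1 - goldenRatio) • y ∈ S := by
      refine ⟨hT.reflection_mem_of_eq hyT hα (by rw [real_inner_comm, hc]), fun h => hyU ?_,
        α, hαU, ?_⟩
      · have h1 := U.sub_mem hαU h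
        rw [sub_sub_cancel] at h1
        exact (U.smul_mem_iff (by linarith)).1 h1
      · rw [inner_sub_right, real_inner_smul_right, hT.inner_self α hα, real_inner_comm]
        nlinarith
    have h := hmin₀ _ hy'
    rw [← hyb] at h
    simp only [hb, map_sub, map_smul, hbU α hαU, zero_sub, norm_neg, norm_smul,
      Real.norm_eq_abs] at h
    rw [abs_of_neg (by linarith)] at h
    have := hb0 y hyU
    simp only [hb] at this
    nlinarith
  have hgt := hT.neg_two_lt_cartan hyT hyU hα hαU
  rcases hT.cartan_cases hyT hα with ⟨n, -, -, hn⟩ | h | h | h | h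
  · have h1 : (-2 : ℝ) < n := by linarith
    have h2 : (n : ℝ) ≤ 0 := by linarith
    have h1' : -2 < n := by exact_mod_cast h1
    have h2' : n ≤ 0 := by exact_mod_cast h2
    obtain rfl | rfl : n = 0 ∨ n = -1 := by omega
    · exact .inl (by simpa using hn)
    · exact .inr (.inl (by simpa using hn))
  · linarith
  · exact .inr (.inr h)
  · linarith
  · exact absurd h hnot

/-- A non-crystallographic system contains a base of type `H₂`. -/
theorem exists_H2_base (hT : IsGoldenSystem T) (h : ∃ α ∈ T, ∃ β ∈ T, ∀ n : ℤ,
    2 * inner ℝ α β ≠ n) : ∃ α ∈ T, ∃ β ∈ T, 2 * inner ℝ α β = -goldenRatio := by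
  obtain ⟨α, hα, β, hβ, hne⟩ := h
  -- (φ - 1)² - 2 = -φ.
  have key : 2 * inner ℝ α β = goldenRatio - 1 ∨ 2 * inner ℝ α β = 1 - goldenRatio →
      ∃ α ∈ T, ∃ β ∈ T, 2 * inner ℝ α β = -goldenRatio := by
    intro h
    obtain ⟨γ, hγ, hc⟩ := hT.exists_cartan_sq_sub_two hα hβ
    refine ⟨α, hα, γ, hγ, ?_⟩
    rw [hc]
    rcases h with h | h <;> rw [h] <;> linarith [goldenRatio_sq]
  rcases hT.cartan_cases hα hβ with ⟨n, -, -, hn⟩ | h | h | h | h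
  · exact absurd hn (hne n)
  · exact ⟨α, hα, -β, hT.neg_mem hβ, by rw [inner_neg_right]; linarith⟩
  · exact ⟨α, hα, β, hβ, h⟩
  · exact key (.inl h)
  · exact key (.inr h)

end IsGoldenSystem

/-- Three roots forming a base of type `H₃`. -/
structure IsH3Base {V : Type*} [NormedAddCommGroup V] [InnerProductSpace ℝ V] (T : Set V)
    (α β γ : V) : Prop where
  mem₁ : α ∈ T
  mem₂ : β ∈ T
  mem₃ : γ ∈ T
  cartan₁₂ : 2 * inner ℝ α β = -goldenRatio
  cartan₂₃ : 2 * inner ℝ β γ = -1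
  cartan₁₃ : inner ℝ α γ = 0

/-- Four roots forming a base of type `H₄`. -/
structure IsH4Base {V : Type*} [NormedAddCommGroup V] [InnerProductSpace ℝ V] (T : Set V)
    (α β γ δ : V) : Prop extends IsH3Base T α β γ where
  mem₄ : δ ∈ T
  cartan₃₄ : 2 * inner ℝ γ δ = -1
  cartan₁₄ : inner ℝ α δ = 0
  cartan₂₄ : inner ℝ β δ = 0

/-! ### Reflections in base coordinates, and extension of bases -/

section Bases

variable {V : Type*} [NormedAddCommGroup V] [InnerProductSpace ℝ V] {T : Set V} {α β γ δ : V}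

namespace IsH3Base

theorem reflection₁ (hT : IsGoldenSystem T) (h : IsH3Base T α β γ) {a b c a' : ℝ}
    (hx : a • α + b • β + c • γ ∈ T) (ha : a' = goldenRatio * b - a) :
    a' • α + b • β + c • γ ∈ T := by
  have h1 := hT.reflection_mem_of_eq (c := 2 * a - goldenRatio * b) h.mem₁ hx (by
    simp only [inner_add_left, real_inner_smul_left]
    rw [hT.inner_self α h.mem₁, real_inner_comm α β, real_inner_comm α γ, h.cartan₁₃]
    linear_combination b * h.cartan₁₂)
  convert h1 using 1
  rw [ha]
  module

theorem reflection₂ (hT : IsGoldenSystem T) (h : IsH3Base T α β γ) {a b c b' : ℝ}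
    (hx : a • α + b • β + c • γ ∈ T) (hb : b' = goldenRatio * a + c - b) :
    a • α + b' • β + c • γ ∈ T := by
  have h1 := hT.reflection_mem_of_eq (c := 2 * b - goldenRatio * a - c) h.mem₂ hx (by
    simp only [inner_add_left, real_inner_smul_left]
    rw [hT.inner_self β h.mem₂, real_inner_comm β γ]
    linear_combination a * h.cartan₁₂ + c * h.cartan₂₃)
  convert h1 using 1
  rw [hb]
  module

theorem reflection₃ (hT : IsGoldenSystem T) (h : IsH3Base T α β γ) {a b c c' : ℝ}
    (hx : a • α + b • β + c • γ ∈ T) (hc : c' = b - c) :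
    a • α + b • β + c' • γ ∈ T := by
  have h1 := hT.reflection_mem_of_eq (c := 2 * c - b) h.mem₃ hx (by
    simp only [inner_add_left, real_inner_smul_left]
    rw [hT.inner_self γ h.mem₃, h.cartan₁₃]
    linear_combination b * h.cartan₂₃)
  convert h1 using 1
  rw [hc]
  module

/-- Not the highest root: the chain of simple reflections stops once the coordinates are large
enough to exclude every extension except H₄. -/
theorem high_root_mem (hT : IsGoldenSystem T) (h : IsH3Base T α β γ) :
    (1 + goldenRatio) • α + (1 + goldenRatio) • β + goldenRatio • γ ∈ T := by
  have hsq := goldenRatio_sq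
  have s₀ : (1 : ℝ) • α + (0 : ℝ) • β + (0 : ℝ) • γ ∈ T := by simpa using h.mem₁
  have s₁ := h.reflection₂ hT s₀ (b' := goldenRatio) (by ring)
  have s₂ := h.reflection₁ hT s₁ (a' := goldenRatio) (by linarith)
  have s₃ := h.reflection₃ hT s₂ (c' := goldenRatio) (by ring)
  have s₄ := h.reflection₂ hT s₃ (b' := 1 + goldenRatio) (by linarith)
  exact h.reflection₁ hT s₄ (by linarith)

end IsH3Base

namespace IsH4Base

theorem reflection₁ (hT : IsGoldenSystem T) (h : IsH4Base T α β γ δ) {a b c d a' : ℝ}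
    (hx : a • α + b • β + c • γ + d • δ ∈ T) (ha : a' = goldenRatio * b - a) :
    a' • α + b • β + c • γ + d • δ ∈ T := by
  have h1 := hT.reflection_mem_of_eq (c := 2 * a - goldenRatio * b) h.mem₁ hx (by
    simp only [inner_add_left, real_inner_smul_left]
    rw [hT.inner_self α h.mem₁, real_inner_comm α β, real_inner_comm α γ, h.cartan₁₃,
      real_inner_comm α δ, h.cartan₁₄]
    linear_combination b * h.cartan₁₂)
  convert h1 using 1
  rw [ha]
  module

theorem reflection₂ (hT : IsGoldenSystem T) (h : IsH4Base T α β γ δ) {a b c d b' : ℝ}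
    (hx : a • α + b • β + c • γ + d • δ ∈ T) (hb : b' = goldenRatio * a + c - b) :
    a • α + b' • β + c • γ + d • δ ∈ T := by
  have h1 := hT.reflection_mem_of_eq (c := 2 * b - goldenRatio * a - c) h.mem₂ hx (by
    simp only [inner_add_left, real_inner_smul_left]
    rw [hT.inner_self β h.mem₂, real_inner_comm β γ, real_inner_comm β δ, h.cartan₂₄]
    linear_combination a * h.cartan₁₂ + c * h.cartan₂₃)
  convert h1 using 1
  rw [hb]
  module

theorem reflection₃ (hT : IsGoldenSystem T) (h : IsH4Base T α β γ δ) {a b c d c' : ℝ}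
    (hx : a • α + b • β + c • γ + d • δ ∈ T) (hc : c' = b + d - c) :
    a • α + b • β + c' • γ + d • δ ∈ T := by
  have h1 := hT.reflection_mem_of_eq (c := 2 * c - b - d) h.mem₃ hx (by
    simp only [inner_add_left, real_inner_smul_left]
    rw [hT.inner_self γ h.mem₃, h.cartan₁₃, real_inner_comm γ δ]
    linear_combination b * h.cartan₂₃ + d * h.cartan₃₄)
  convert h1 using 1
  rw [hc]
  module

theorem reflection₄ (hT : IsGoldenSystem T) (h : IsH4Base T α β γ δ) {a b c d d' : ℝ}
    (hx : a • α + b • β + c • γ + d • δ ∈ T) (hd : d' = c - d) :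
    a • α + b • β + c • γ + d' • δ ∈ T := by
  have h1 := hT.reflection_mem_of_eq (c := 2 * d - c) h.mem₄ hx (by
    simp only [inner_add_left, real_inner_smul_left]
    rw [hT.inner_self δ h.mem₄, h.cartan₁₄, h.cartan₂₄]
    linear_combination c * h.cartan₃₄)
  convert h1 using 1
  rw [hd]
  module

/-- Again not the highest root; what matters is that every coordinate exceeds 2. -/
theorem high_root_mem (hT : IsGoldenSystem T) (h : IsH4Base T α β γ δ) :
    (1 + 2 * goldenRatio) • α + (2 + 2 * goldenRatio) • β + (2 + goldenRatio) • γ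
      + (1 + goldenRatio) • δ ∈ T := by
  have hsq := goldenRatio_sq
  have s₀ : (0 : ℝ) • α + (1 : ℝ) • β + (0 : ℝ) • γ + (0 : ℝ) • δ ∈ T := by
    simpa using h.mem₂
  have s₁ := h.reflection₁ hT s₀ (a' := goldenRatio) (by ring)
  have s₂ := h.reflection₃ hT s₁ (c' := 1) (by ring)
  have s₃ := h.reflection₂ hT s₂ (b' := 1 + goldenRatio) (by linarith)
  have s₄ := h.reflection₁ hT s₃ (a' := 1 + goldenRatio) (by linarith)
  have s₅ := h.reflection₄ hT s₄ (d' := 1) (by ring)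
  have s₆ := h.reflection₃ hT s₅ (c' := 1 + goldenRatio) (by ring)
  have s₇ := h.reflection₂ hT s₆ (b' := 1 + 2 * goldenRatio) (by linarith)
  have s₈ := h.reflection₁ hT s₇ (a' := 1 + 2 * goldenRatio) (by linarith)
  have s₉ := h.reflection₂ hT s₈ (b' := 2 + 2 * goldenRatio) (by linarith)
  have s₁₀ := h.reflection₃ hT s₉ (c' := 2 + goldenRatio) (by ring)
  exact h.reflection₄ hT s₁₀ (by ring)

end IsH4Base

theorem inner_eq_zero_of_mem_span {s : Set V} {x y : V} (hx : x ∈ Submodule.span ℝ s)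
    (h : ∀ z ∈ s, inner ℝ y z = 0) : inner ℝ x y = 0 := by
  induction hx using Submodule.span_induction with
  | mem z hz => rw [real_inner_comm, h z hz]
  | zero => exact inner_zero_left y
  | add u v _ _ hu hv => rw [inner_add_left, hu, hv, add_zero]
  | smul a u _ hu => rw [real_inner_smul_left, hu, mul_zero]

namespace IsGoldenSystem

/-- The root φ(α + β) forces the coefficients of y against α and β to sum to more than -2/φ > -φ. So
they are not both nonzero and neither is -φ: y attaches to exactly one end by -1, and α, β are
swapped if that end is α. -/
theorem exists_H3_base (hT : IsGoldenSystem T) (hind : IsIndecomposable T) (hα : α ∈ T)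
    (hβ : β ∈ T) (hαβ : 2 * inner ℝ α β = -goldenRatio)
    (hspan : ¬ T ⊆ Submodule.span ℝ {α, β}) : ∃ α β γ, IsH3Base T α β γ := by
  have hφ := goldenRatio_gt
  have hφ' := goldenRatio_lt
  have hsq := goldenRatio_sq
  have hαU : α ∈ Submodule.span ℝ {α, β} := Submodule.subset_span (by simp)
  have hβU : β ∈ Submodule.span ℝ {α, β} := Submodule.subset_span (by simp)
  have hβα : 2 * inner ℝ β α = -goldenRatio := by rw [real_inner_comm, hαβ]
  have : FiniteDimensional ℝ (Submodule.span ℝ {α, β}) :=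
    FiniteDimensional.span_of_finite ℝ (Set.toFinite _)
  obtain ⟨y, hy, hyU, ⟨x, hx, hxy⟩, hval⟩ :=
    hT.exists_root_notMem hind _ ⟨α, hα, hαU⟩ hspan (α + β)
  have hθ : goldenRatio • α + goldenRatio • β ∈ T := by
    have h1 := hT.reflection_mem_of_eq hα hβ hβα
    have h2 := hT.reflection_mem_of_eq (c := 1 - goldenRatio) hβ h1 (by
      rw [inner_sub_left, real_inner_smul_left, hT.inner_self β hβ]
      linear_combination goldenRatio * hαβ - hsq)
    convert h2 using 1
    module
  have hlt := hT.neg_two_lt_cartan hy hyU hθ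
    (Submodule.add_mem _ (Submodule.smul_mem _ _ hαU) (Submodule.smul_mem _ _ hβU))
  rw [inner_add_right, real_inner_smul_right, real_inner_smul_right] at hlt
  have hvα := hval α hα hαU (by rw [inner_add_right, hT.inner_self α hα]; linarith)
  have hvβ := hval β hβ hβU (by rw [inner_add_right, hT.inner_self β hβ]; linarith)
  rcases hvα with h1 | h1 | h1 <;> rcases hvβ with h2 | h2 | h2
  · refine absurd (inner_eq_zero_of_mem_span hx ?_) hxy
    rintro z (rfl | rfl) <;> linarith
  · exact ⟨α, β, y, hα, hβ, hy, hαβ, by rw [real_inner_comm, h2],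
      by rw [real_inner_comm]; linarith⟩
  · nlinarith
  · exact ⟨β, α, y, hβ, hα, hy, hβα, by rw [real_inner_comm, h1],
      by rw [real_inner_comm]; linarith⟩
  all_goals nlinarith

/-- With test coordinates 1 + φ, 1 + φ, φ, any nonzero coefficient at α or β, or -φ at γ, brings the
pairing to -2 or below. Only -1 at γ survives. -/
theorem exists_H4_base (hT : IsGoldenSystem T) (hind : IsIndecomposable T)
    (h : IsH3Base T α β γ) (hspan : ¬ T ⊆ Submodule.span ℝ {α, β, γ}) :
    ∃ δ, IsH4Base T α β γ δ := by
  have hφ := goldenRatio_gt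
  have hφ' := goldenRatio_lt
  have hsq := goldenRatio_sq
  have h₁ := h.cartan₁₂
  have h₂ := h.cartan₂₃
  have h₃ := h.cartan₁₃
  have hαU : α ∈ Submodule.span ℝ {α, β, γ} := Submodule.subset_span (by simp)
  have hβU : β ∈ Submodule.span ℝ {α, β, γ} := Submodule.subset_span (by simp)
  have hγU : γ ∈ Submodule.span ℝ {α, β, γ} := Submodule.subset_span (by simp)
  have : FiniteDimensional ℝ (Submodule.span ℝ {α, β, γ}) :=
    FiniteDimensional.span_of_finite ℝ (Set.toFinite _)
  obtain ⟨y, hy, hyU, ⟨x, hx, hxy⟩, hval⟩ := hT.exists_root_notMem hind _ ⟨α, h.mem₁, hαU⟩ hspan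
    -- The numbers only need to make ρ pair positively with all three base roots.
    ((0.85 : ℝ) • α + (1 : ℝ) • β + (0.55 : ℝ) • γ)
  have hlt := hT.neg_two_lt_cartan hy hyU (h.high_root_mem hT)
    (Submodule.add_mem _ (Submodule.add_mem _ (Submodule.smul_mem _ _ hαU)
      (Submodule.smul_mem _ _ hβU)) (Submodule.smul_mem _ _ hγU))
  simp only [inner_add_right, real_inner_smul_right] at hlt hval
  have hvα := hval α h.mem₁ hαU (by
    rw [hT.inner_self α h.mem₁, h₃]; linarith)
  have hvβ := hval β h.mem₂ hβU (by
    rw [hT.inner_self β h.mem₂, real_inner_comm α β]; linarith)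
  have hvγ := hval γ h.mem₃ hγU (by
    rw [hT.inner_self γ h.mem₃, real_inner_comm α γ, real_inner_comm β γ, h₃]; linarith)
  have hα0 : 2 * inner ℝ y α ≤ 0 := by rcases hvα with h | h | h <;> linarith
  have hβ0 : 2 * inner ℝ y β ≤ 0 := by rcases hvβ with h | h | h <;> linarith
  have hγ0 : 2 * inner ℝ y γ ≤ 0 := by rcases hvγ with h | h | h <;> linarith
  replace hvα : 2 * inner ℝ y α = 0 := by
    rcases hvα with h | h | h
    · exact h
    all_goals nlinarith
  replace hvβ : 2 * inner ℝ y β = 0 := by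
    rcases hvβ with h | h | h
    · exact h
    all_goals nlinarith
  rcases hvγ with h4 | h4 | h4
  · refine absurd (inner_eq_zero_of_mem_span hx ?_) hxy
    rintro z (rfl | rfl | rfl) <;> linarith
  · exact ⟨y, h, hy, by rw [real_inner_comm, h4], by rw [real_inner_comm]; linarith,
      by rw [real_inner_comm]; linarith⟩
  · nlinarith

/-- Every test coordinate exceeds 2, so one nonzero coefficient, being at most -1, already violates
the bound; y would be orthogonal to U. -/
theorem subset_span_of_H4_base (hT : IsGoldenSystem T) (hind : IsIndecomposable T)
    (h : IsH4Base T α β γ δ) : T ⊆ Submodule.span ℝ {α, β, γ, δ} := by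
  by_contra hspan
  have hφ := goldenRatio_gt
  have hφ' := goldenRatio_lt
  have h₁ := h.cartan₁₂
  have h₂ := h.cartan₂₃
  have h₃ := h.cartan₁₃
  have h₄ := h.cartan₃₄
  have h₅ := h.cartan₁₄
  have h₆ := h.cartan₂₄
  have hαU : α ∈ Submodule.span ℝ {α, β, γ, δ} := Submodule.subset_span (by simp)
  have hβU : β ∈ Submodule.span ℝ {α, β, γ, δ} := Submodule.subset_span (by simp)
  have hγU : γ ∈ Submodule.span ℝ {α, β, γ, δ} := Submodule.subset_span (by simp)
  have hδU : δ ∈ Submodule.span ℝ {α, β, γ, δ} := Submodule.subset_span (by simp)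
  have : FiniteDimensional ℝ (Submodule.span ℝ {α, β, γ, δ}) :=
    FiniteDimensional.span_of_finite ℝ (Set.toFinite _)
  obtain ⟨y, hy, hyU, ⟨x, hx, hxy⟩, hval⟩ := hT.exists_root_notMem hind _ ⟨α, h.mem₁, hαU⟩ hspan
    -- Chosen so that ρ pairs positively with all four base roots; the margins are thin.
    ((0.812 : ℝ) • α + (1 : ℝ) • β + (0.68 : ℝ) • γ + (0.35 : ℝ) • δ)
  have hlt := hT.neg_two_lt_cartan hy hyU (h.high_root_mem hT)
    (Submodule.add_mem _ (Submodule.add_mem _ (Submodule.add_mem _ (Submodule.smul_mem _ _ hαU)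
      (Submodule.smul_mem _ _ hβU)) (Submodule.smul_mem _ _ hγU)) (Submodule.smul_mem _ _ hδU))
  simp only [inner_add_right, real_inner_smul_right] at hlt hval
  have hvα := hval α h.mem₁ hαU (by
    rw [hT.inner_self α h.mem₁, h₃, h₅]; linarith)
  have hvβ := hval β h.mem₂ hβU (by
    rw [hT.inner_self β h.mem₂, real_inner_comm α β, h₆]; linarith)
  have hvγ := hval γ h.mem₃ hγU (by
    rw [hT.inner_self γ h.mem₃, real_inner_comm α γ, real_inner_comm β γ, h₃]; linarith)
  have hvδ := hval δ h.mem₄ hδU (by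
    rw [hT.inner_self δ h.mem₄, real_inner_comm α δ, real_inner_comm β δ, real_inner_comm γ δ,
      h₅, h₆]
    linarith)
  have dichotomy : ∀ {t : ℝ}, t = 0 ∨ t = -1 ∨ t = -goldenRatio → t = 0 ∨ t ≤ -1 := by
    rintro t (h | h | h)
    · exact .inl h
    · exact .inr h.le
    · exact .inr (by linarith)
  have nonpos : ∀ {t : ℝ}, t = 0 ∨ t = -1 ∨ t = -goldenRatio → t ≤ 0 := by
    rintro t (h | h | h) <;> linarith
  have hα0 := nonpos hvα
  have hβ0 := nonpos hvβ
  have hγ0 := nonpos hvγ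
  have hδ0 := nonpos hvδ
  refine hxy (inner_eq_zero_of_mem_span hx ?_)
  rintro z (rfl | rfl | rfl | rfl)
  · rcases dichotomy hvα with h | h
    · linarith
    · nlinarith
  · rcases dichotomy hvβ with h | h
    · linarith
    · nlinarith
  · rcases dichotomy hvγ with h | h
    · linarith
    · nlinarith
  · rcases dichotomy hvδ with h | h
    · linarith
    · nlinarith

/-- An indecomposable non-crystallographic system over `ℤ[φ]` has rank at most four. -/
theorem realRank_le_four (hT : IsGoldenSystem T) (hind : IsIndecomposable T)
    (hnc : ∃ α ∈ T, ∃ β ∈ T, ∀ n : ℤ, 2 * inner ℝ α β ≠ n) : realRank T ≤ 4 := by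
  classical
  have key : ∀ s : Finset V, s.card ≤ 4 → T ⊆ Submodule.span ℝ (s : Set V) →
      realRank T ≤ 4 := fun s hs h =>
    (Submodule.finrank_mono (Submodule.span_le.2 h)).trans
      ((finrank_span_finset_le_card s).trans hs)
  obtain ⟨α, hα, β, hβ, hαβ⟩ := hT.exists_H2_base hnc
  by_cases h2 : T ⊆ Submodule.span ℝ {α, β}
  · exact key {α, β} (Finset.card_le_two.trans (by norm_num)) (by simpa using h2)
  obtain ⟨α, β, γ, h⟩ := hT.exists_H3_base hind hα hβ hαβ h2
  by_cases h3 : T ⊆ Submodule.span ℝ {α, β, γ}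
  · exact key {α, β, γ} (Finset.card_le_three.trans (by norm_num)) (by simpa using h3)
  obtain ⟨δ, h⟩ := hT.exists_H4_base hind h h3
  exact key {α, β, γ, δ} Finset.card_le_four (by simpa using hT.subset_span_of_H4_base hind h)

end IsGoldenSystem

end Bases

/-- A root-shell system of unit vectors over `ℤ[φ]` is a golden system. -/
theorem IsRootShellSystem.isGoldenSystem {V : Type*} [NormedAddCommGroup V]
    [InnerProductSpace ℝ V] {T : Set V} (hT : IsRootShellSystem goldenIntegers T)
    (h1 : ∀ x ∈ T, inner ℝ x x = 1) : IsGoldenSystem T where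
  finite := hT.finite
  inner_self := h1
  reflection_mem α hα x hx := by
    have h := hT.reflection_image α hα ▸ Set.mem_image_of_mem (rootReflection α) hx
    simpa only [rootReflection, h1 α hα, div_one] using h
  cartan_mem α hα β hβ := by
    simpa only [cartanCoeff, h1 α hα, div_one] using hT.cartan_mem α hα β hβ

theorem corollary6p2 :
    ¬ ∃ G : Submodule goldenIntegers Octonion,
      Octonion.IsOrder goldenIntegers G ∧
      IsRootShellSystem goldenIntegers (Octonion.unitShell G) ∧
      IsIndecomposable (Octonion.unitShell G) ∧
      IsNonCrystallographic (Octonion.unitShell G) ∧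
      realRank (Octonion.unitShell G) = 8 := by
  rintro ⟨G, -, hT, hind, ⟨α, hα, β, hβ, hnc⟩, hrank⟩
  have h1 : ∀ x ∈ Octonion.unitShell G, inner ℝ x x = (1 : ℝ) := fun x hx => by
    rw [real_inner_self_eq_norm_sq, ← Octonion.N_eq_norm_sq, hx.2]
  have h := (hT.isGoldenSystem h1).realRank_le_four hind ⟨α, hα, β, hβ, fun n => by
    simpa only [cartanCoeff, h1 α hα, div_one] using hnc n⟩
  omega
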